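/- All graphs are finite and loopless; multiple edges are allowed. For a graph $H$, let $I(H)$ denote the set of isolated vertices of $H$ (vertices incident with no edge). For a real function $t$ on $V(G)$, the graph $G$ is called *$t$-iso-tough* if $$\sum_{v\in I(G\setminus S)} t(v)\le |S|\qquad\text{for all } S\subseteq V(G).$$ For integer-valued functions $g,f$ on $V(G)$, a *$(g,f)$-factor* of $G$ is a spanning subgraph $F$ of $G$ with $g(v)\le d_F(v)\le f(v)$ for every vertex $v$. Write $\min f$ and $\max f$ for the minimum and the maximum of $f$ over $V(G)$. **Theorem.** Let $G$ be a graph and let $g$ and $f$ be two nonnegative integer-valued functions on $V(G)$ with $g(v)<f(v)$ for every vertex $v$. For each vertex $v$, let $\varepsilon_0(v)=1$ if $g(v)$ and $\min f$ have the same parity and $\varepsilon_0(v)=0$ otherwise, and define $$t(v)=\begin{cases} g(v)-1+\dfrac{g(v)}{\min f}, & \text{if } g(v)\le \min f+2,\\[2mm] \dfrac{1}{4\min f}\Big((g(v)+\min f+1)^2-\varepsilon_0(v)\Big)-1, & \text{otherwise.}\end{cases}$$ If $G$ is $\max\{0,t\}$-iso-tough, then $G$ has a $(g,f)$-factor. (One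 has $t(v)<0$ only when $g(v)=0$, so $\max\{0,t\}=t$ when $g$ is positive.) **Corollary 1.** Let $G$ be a graph and let $g$ and $f$ be two nonnegative integer-valued functions on $V(G)$ with $\max g<\min f$. If $G$ is $\max\{0,\,g-1+\frac{g}{\min f}\}$-iso-tough, then $G$ has a $(g,f)$-factor. **Corollary 2.** Let $f$ be a nonnegative integer-valued function on $V(G)$. If $G$ is $f(f+1)$-iso-tough, then $G$ has an $(f,f+1)$-factor. -/

import Mathlib

namespace IsoTough

variable {α β : Type*}

/-- The degree of `v` in a loopless multigraph: the number of edges incident with `v`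
(parallel edges are counted separately). -/
noncomputable def degree (G : Graph α β) (v : α) : ℕ :=
  (G.incidenceSet v).ncard

/-- `I(G)`: the set of isolated vertices of `G`. -/
def isolatedVertices (G : Graph α β) : Set α :=
  {v | v ∈ G.vertexSet ∧ ∀ e, ¬ G.Inc e v}

/-- `G` is `t`-iso-tough, for a real function `t` on the vertices of a finite graph:
`∑_{v ∈ I(G \ S)} t(v) ≤ |S|` for all `S ⊆ V(G)`. -/
def IsIsoTough (G : Graph α β) (t : α → ℝ) : Prop :=
  ∀ S : Set α, S ⊆ G.vertexSet →
    ∑ᶠ v ∈ isolatedVertices (G.deleteVerts S), t v ≤ (S.ncard : ℝ)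

/-- `F` is a `(g, f)`-factor of `G`: a spanning subgraph with
`g(v) ≤ d_F(v) ≤ f(v)` for every vertex `v`. -/
def IsFactor (G F : Graph α β) (g f : α → ℕ) : Prop :=
  F.IsSpanningSubgraph G ∧ ∀ v ∈ G.vertexSet, g v ≤ degree F v ∧ degree F v ≤ f v

/-- `min f`, the minimum of `f` over the vertices of a finite nonempty graph. -/
noncomputable def minValue (G : Graph α β) (f : α → ℕ) : ℕ :=
  sInf (f '' G.vertexSet)

/-- `max f`, the maximum of `f` over the vertices of a finite nonempty graph. -/
noncomputable def maxValue (G : Graph α β) (f : α → ℕ) : ℕ :=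
  sSup (f '' G.vertexSet)

/-- `ε₀ ∈ {0, 1}`, with `ε₀ = 1` if and only if `a` and `m` have the same parity. -/
noncomputable def parityTerm (a m : ℕ) : ℝ :=
  if a % 2 = m % 2 then 1 else 0

/-- The piecewise function of a value `a = g(v)` and of `m = min f`:
`a - 1 + a / m` if `a ≤ m + 2`, and `((a + m + 1)² - ε₀) / (4 m) - 1` otherwise. -/
noncomputable def threshold (a m : ℕ) : ℝ :=
  if a ≤ m + 2 then (a : ℝ) - 1 + (a : ℝ) / (m : ℝ)
  else 1 / (4 * (m : ℝ)) * (((a : ℝ) + (m : ℝ) + 1) ^ 2 - parityTerm a m) - 1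

end IsoTough

namespace IsoTough

open Finset

/-! Since `g < f`, a factor exists as soon as every `S` satisfies `∑_{v ∉ S} max(0, g v - d v) ≤
∑_{v ∈ S} f v`, where `d` is the degree in `G \ S`. Alternating walks prove this in
`le_edgeDegree_of_minimal`. To verify the condition, weight the vertices with `d v < g v` by `g v -
d v`. A greedy independent set `I` of such vertices carries the total weight up to factors `d v + 1`
(`exists_independent_weight_le`). Deleting `S` and the neighbours of `I` isolates `I`, so toughness
gives `∑_I (t v - d v) ≤ |S|` (`IsIsoTough.sum_le`). If `(d + 1)(g - d) ≤ m (t - d)` with `m ≤ f`,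
the deficiency is at most `m |S| ≤ ∑_S f`. The function `t` of the theorem dominates `d + (d + 1)(g
- d) / m` over integers `d < g`. -/

open scoped Classical in
/-- The number of edges of the finite edge set `F` that are incident with `v`. -/
noncomputable def edgeDegree {α β : Type*} (G : Graph α β) (F : Finset β) (v : α) : ℕ :=
  (F.filter fun e => G.Inc e v).card

open scoped Classical in
/-- The number of edges of `F` that are incident with `v` and with no vertex of `S`. -/
noncomputable def edgeDegreeAvoiding {α β : Type*} (G : Graph α β) (F : Finset β)
    (S : Finset α) (v : α) : ℕ :=
  (F.filter fun e => G.Inc e v ∧ ∀ u ∈ S, ¬ G.Inc e u).card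

/-- Edge sets obtained from `F` by switching the edges along an alternating walk that starts at
`r` with an edge outside the current set; `AlternatingReach G F r F' v b` says that the walk ends
at `v` and that its last edge was added (`b = true`) or removed, or that the walk is trivial
(`b = false`). -/
inductive AlternatingReach {α β : Type*} [DecidableEq β] (G : Graph α β) (E F : Finset β) (r : α) :
    Finset β → α → Bool → Prop
  | start : AlternatingReach G E F r F r false
  | add {F' : Finset β} {v w : α} {e : β} : AlternatingReach G E F r F' v false → e ∈ E →
      e ∉ F' → G.IsLink e v w → AlternatingReach G E F r (insert e F') w true
  | remove {F' : Finset β} {v w : α} {e : β} : AlternatingReach G E F r F' v true →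
      e ∈ F' → G.IsLink e v w → AlternatingReach G E F r (F'.erase e) w false

/-! ### Alternating walks and the deficiency criterion -/

section Switching

variable {α β : Type*} [DecidableEq β] {G : Graph α β}

lemma edgeDegree_insert [DecidableEq α] (hloop : G.Loopless) {F : Finset β} {e : β} {v w : α} (he : e ∉ F)
    (h : G.IsLink e v w) (x : α) :
    edgeDegree G (insert e F) x =
      edgeDegree G F x + (if x = v then 1 else 0) + (if x = w then 1 else 0) := by
  classical
  have hne : v ≠ w := h.ne
  unfold edgeDegree
  rw [filter_insert]
  by_cases hx : G.Inc e x
  · rw [if_pos hx, card_insert_of_notMem (by simp [he])]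
    rcases hx.eq_or_eq_of_isLink h with rfl | rfl
    · simp [hne]
    · simp [hne.symm]
  · have h1 : x ≠ v := by rintro rfl; exact hx h.inc_left
    have h2 : x ≠ w := by rintro rfl; exact hx h.inc_right
    simp [hx, h1, h2]

namespace AlternatingReach

variable {E F F' : Finset β} {r v : α} {b : Bool}

lemma subset (hF : F ⊆ E) (h : AlternatingReach G E F r F' v b) : F' ⊆ E := by
  induction h with
  | start => exact hF
  | add _ he _ _ ih => exact insert_subset he ih
  | remove _ _ _ ih => exact (erase_subset _ _).trans ih

lemma mem_vertexSet (hr : r ∈ G.vertexSet) (h : AlternatingReach G E F r F' v b) :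
    v ∈ G.vertexSet := by
  cases h with
  | start => exact hr
  | add _ _ _ hl => exact hl.right_mem
  | remove _ _ hl => exact hl.right_mem

/-- At each inner visit an added and a removed edge cancel, so only the two ends of the walk change
degree. Corrections stand on both sides to avoid truncated subtraction. -/
lemma edgeDegree_eq [DecidableEq α] (hloop : G.Loopless) (h : AlternatingReach G E F r F' v b) (x : α) :
    edgeDegree G F' x + (if b = false ∧ x = v then 1 else 0) =
      edgeDegree G F x + (if x = r then 1 else 0) + (if b = true ∧ x = v then 1 else 0) := by
  induction h with
  | start => simp
  | add _ _ he hl ih =>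
    have := edgeDegree_insert hloop he hl x
    simp at ih ⊢
    omega
  | @remove F' v w e _ he hl ih =>
    have := edgeDegree_insert hloop (notMem_erase e F') hl x
    rw [insert_erase he] at this
    simp at ih ⊢
    omega

/-- An edge in which a reached edge set differs from `F` joins a vertex reached by an added edge
to a vertex reached by a removed edge. -/
lemma symmDiff_ends (h : AlternatingReach G E F r F' v b) {e : β}
    (he : (e ∈ F ∧ e ∉ F') ∨ (e ∉ F ∧ e ∈ F')) :
    ∃ x y, G.IsLink e x y ∧ (∃ F₁, AlternatingReach G E F r F₁ x true) ∧
      ∃ F₁, AlternatingReach G E F r F₁ y false := by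
  induction h with
  | start => tauto
  | @add F' v w a h ha ha' hl ih =>
    by_cases hea : e = a
    · subst hea
      exact ⟨w, v, hl.symm, ⟨_, add h ha ha' hl⟩, _, h⟩
    · apply ih
      simpa [hea] using he
  | @remove F' v w a h ha hl ih =>
    by_cases hea : e = a
    · subst hea
      exact ⟨v, w, hl, ⟨_, h⟩, _, remove h ha hl⟩
    · apply ih
      simpa [hea] using he

end AlternatingReach

/-- An edge set with minimum deficiency has deficiency zero, if no vertex set violates the
deficiency condition. -/
lemma le_edgeDegree_of_minimal [DecidableEq α] (hloop : G.Loopless) {V : Finset α} {E F : Finset β}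
    (hV : ∀ v, v ∈ V ↔ v ∈ G.vertexSet) {g f : α → ℕ} (hgf : ∀ v ∈ V, g v < f v)
    (hcond : ∀ S ⊆ V, ∑ v ∈ V \ S, (g v - edgeDegreeAvoiding G E S v) ≤ ∑ v ∈ S, f v)
    (hFE : F ⊆ E) (hFf : ∀ v ∈ V, edgeDegree G F v ≤ f v)
    (hmin : ∀ F' ⊆ E, (∀ v ∈ V, edgeDegree G F' v ≤ f v) →
      ∑ v ∈ V, (g v - edgeDegree G F v) ≤ ∑ v ∈ V, (g v - edgeDegree G F' v))
    {r : α} (hr : r ∈ V) : g r ≤ edgeDegree G F r := by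
  classical
  by_contra! hlt
  have improve : ∀ F' ⊆ E, (∀ v ∈ V, edgeDegree G F' v ≤ f v) →
      (∀ v ∈ V, g v - edgeDegree G F' v ≤ g v - edgeDegree G F v) →
      edgeDegree G F r < edgeDegree G F' r → False := by
    intro F' hF' hf' hle hr'
    refine (hmin F' hF' hf').not_gt (sum_lt_sum hle ⟨r, hr, ?_⟩)
    omega
  let A : Finset α := V.filter fun v => ∃ F', AlternatingReach G E F r F' v true
  let B : Finset α := V.filter fun v => ∃ F', AlternatingReach G E F r F' v false
  have memA : ∀ {v F'}, AlternatingReach G E F r F' v true → v ∈ A := fun h =>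
    mem_filter.2 ⟨(hV _).2 (h.mem_vertexSet ((hV _).1 hr)), _, h⟩
  have memB : ∀ {v F'}, AlternatingReach G E F r F' v false → v ∈ B := fun h =>
    mem_filter.2 ⟨(hV _).2 (h.mem_vertexSet ((hV _).1 hr)), _, h⟩
  have hA : ∀ v ∈ A, edgeDegree G F v = f v := by
    intro v hv
    obtain ⟨hvV, F', h⟩ := mem_filter.1 hv
    by_contra hne
    have hd := h.edgeDegree_eq hloop
    simp at hd
    refine improve F' (h.subset hFE) (fun x hx => ?_) (fun x _ => ?_) ?_
    -- A closed walk raises the degree of `r` by two, which is allowed: `d_F(r) + 2 ≤ g r + 1 ≤ f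
    -- r`.
    · have := hFf x hx
      have := hgf x hx
      have := hd x
      split_ifs at this <;> subst_vars <;> omega
    · rw [hd x]; omega
    · rw [hd r]; simp; omega
  have hB : ∀ v ∈ B, edgeDegree G F v ≤ g v := by
    intro v hv
    obtain ⟨hvV, F', h⟩ := mem_filter.1 hv
    by_contra! hgt
    have hd := h.edgeDegree_eq hloop
    simp at hd
    have hvr : r ≠ v := by rintro rfl; omega
    refine improve F' (h.subset hFE) (fun x hx => ?_) (fun x _ => ?_) ?_
    · have := hFf x hx
      have := hgf x hx
      have := hd x
      split_ifs at this <;> subst_vars <;> omega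
    · have := hd x
      split_ifs at this <;> subst_vars <;> omega
    · have := hd r
      simp [hvr] at this
      omega
  have hAB : ∀ v ∈ A, v ∉ B := by
    intro v hvA hvB
    have h1 := hA v hvA
    have h2 := hB v hvB
    have h3 := hgf v (mem_filter.1 hvA).1
    omega
  have hends : ∀ {F' v b e x y}, AlternatingReach G E F r F' v b →
      ((e ∈ F ∧ e ∉ F') ∨ (e ∉ F ∧ e ∈ F')) → G.IsLink e x y →
      (x ∈ A ∧ y ∈ B) ∨ (y ∈ A ∧ x ∈ B) := by
    intro F' v b e x y h he hl
    obtain ⟨a, c, hac, ⟨F₁, h₁⟩, F₂, h₂⟩ := h.symmDiff_ends he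
    rcases hl.eq_and_eq_or_eq_and_eq hac with ⟨rfl, rfl⟩ | ⟨rfl, rfl⟩
    · exact Or.inl ⟨memA h₁, memB h₂⟩
    · exact Or.inr ⟨memA h₁, memB h₂⟩
  have closeB : ∀ {v w e}, v ∈ B → e ∈ E → e ∉ F → G.IsLink e v w → w ∈ A := by
    intro v w e hv he heF hl
    obtain ⟨hvV, F', h⟩ := mem_filter.1 hv
    -- The walk may already have switched `e`; then `e` joins `A` to `B`, and disjointness decides
    -- which end is which.
    by_cases heF' : e ∈ F'
    · rcases hends h (Or.inr ⟨heF, heF'⟩) hl with ⟨h1, h2⟩ | ⟨h1, h2⟩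
      · exact absurd hv (hAB v h1)
      · exact h1
    · exact memA (.add h he heF' hl)
  have closeA : ∀ {v w e}, v ∈ A → e ∈ F → G.IsLink e v w → w ∈ B := by
    intro v w e hv heF hl
    obtain ⟨hvV, F', h⟩ := mem_filter.1 hv
    by_cases heF' : e ∈ F'
    · exact memB (.remove h heF' hl)
    · rcases hends h (Or.inl ⟨heF, heF'⟩) hl with ⟨h1, h2⟩ | ⟨h1, h2⟩
      · exact h2
      · exact absurd h2 (hAB v hv)
  have hrB : r ∈ B := memB .start
  let c : α → ℕ := fun v => (F.filter fun e => G.Inc e v ∧ ∃ u ∈ A, G.Inc e u).card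
  -- Each edge of `F` meeting `A` has exactly one end in `A` and its other end in `B`.
  have hcount : ∑ v ∈ A, f v ≤ ∑ v ∈ B, c v := by
    rw [← sum_congr rfl hA]
    change ∑ v ∈ A, edgeDegree G F v ≤ _
    simp only [edgeDegree, c, card_filter]
    rw [sum_comm, sum_comm (s := B)]
    refine sum_le_sum fun e he => ?_
    by_cases hex : ∃ u ∈ A, G.Inc e u
    · obtain ⟨u, huA, w, hl⟩ := hex
      have hwB := closeA huA he hl
      calc ∑ v ∈ A, (if G.Inc e v then 1 else 0) ≤ ∑ v ∈ A, (if v = u then 1 else 0) := by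
            refine sum_le_sum fun v hv => ?_
            split_ifs with h1 h2
            · rfl
            · rcases h1.eq_or_eq_of_isLink hl with rfl | rfl
              · exact absurd rfl h2
              · exact absurd hwB (hAB _ hv)
            · exact zero_le
            · rfl
        _ = 1 := by simp [huA]
        _ = (if G.Inc e w ∧ ∃ u ∈ A, G.Inc e u then 1 else 0) := by
            rw [if_pos ⟨hl.inc_right, u, huA, hl.inc_left⟩]
        _ ≤ _ := single_le_sum
            (f := fun v => if G.Inc e v ∧ ∃ u ∈ A, G.Inc e u then 1 else 0)
            (fun _ _ => zero_le) hwB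
    · push Not at hex
      rw [sum_eq_zero fun v hv => if_neg (hex v hv)]
      exact zero_le
  -- By `closeB`, an edge at `v` that avoids `A` must lie in `F`. Hence `A` violates `hcond`,
  -- strictly because of `r`.
  have hdeg : ∀ v ∈ B, edgeDegreeAvoiding G E A v + c v ≤ edgeDegree G F v := by
    intro v hv
    unfold edgeDegreeAvoiding edgeDegree
    rw [← card_union_of_disjoint]
    · refine card_le_card fun e he => ?_
      rcases mem_union.1 he with h | h
      · obtain ⟨heE, ⟨w, hl⟩, hno⟩ := mem_filter.1 h
        refine mem_filter.2 ⟨?_, w, hl⟩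
        by_contra heF
        exact hno w (closeB hv heE heF hl) hl.inc_right
      · obtain ⟨heF, hi, _⟩ := mem_filter.1 h
        exact mem_filter.2 ⟨heF, hi⟩
    · rw [disjoint_left]
      intro e h1 h2
      obtain ⟨_, _, u, hu, hi⟩ := mem_filter.1 h2
      exact (mem_filter.1 h1).2.2 u hu hi
  have hBV : B ⊆ V \ A := fun v hv =>
    mem_sdiff.2 ⟨(mem_filter.1 hv).1, fun h => hAB v h hv⟩
  have hlt' : ∑ v ∈ B, c v < ∑ v ∈ B, (g v - edgeDegreeAvoiding G E A v) := by
    refine sum_lt_sum (fun v hv => ?_) ⟨r, hrB, ?_⟩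
    · have := hdeg v hv
      have := hB v hv
      omega
    · have := hdeg r hrB
      omega
  have := hcond A (filter_subset _ _)
  have := sum_le_sum_of_subset (f := fun v => g v - edgeDegreeAvoiding G E A v) hBV
  omega

/-- Sufficiency in the `(g, f)`-factor theorem for `g < f`. -/
theorem exists_isFactor_of_deficiency [DecidableEq α] (hloop : G.Loopless) {V : Finset α} {E : Finset β}
    (hV : ∀ v, v ∈ V ↔ v ∈ G.vertexSet) {g f : α → ℕ} (hgf : ∀ v ∈ V, g v < f v)
    (hcond : ∀ S ⊆ V, ∑ v ∈ V \ S, (g v - edgeDegreeAvoiding G E S v) ≤ ∑ v ∈ S, f v) :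
    ∃ F : Graph α β, IsFactor G F g f := by
  classical
  obtain ⟨F, hF, hmin⟩ := exists_min_image
    (E.powerset.filter fun F => ∀ v ∈ V, edgeDegree G F v ≤ f v)
    (fun F => ∑ v ∈ V, (g v - edgeDegree G F v)) 
    ⟨∅, mem_filter.2 ⟨empty_mem_powerset E, fun v _ => by simp [edgeDegree]⟩⟩
  simp only [mem_filter, mem_powerset] at hF hmin
  refine ⟨G.restrict F, ⟨Graph.restrict_le, rfl⟩, fun v hv => ?_⟩
  have hd : degree (G.restrict (F : Set β)) v = edgeDegree G F v := by
    unfold degree edgeDegree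
    rw [← Set.ncard_coe_finset]
    congr 1
    ext e
    simp [and_comm]
  rw [hd]
  exact ⟨le_edgeDegree_of_minimal hloop hV hgf hcond hF.1 hF.2
    (fun F' h1 h2 => hmin F' ⟨h1, h2⟩) ((hV v).2 hv), hF.2 v ((hV v).2 hv)⟩

end Switching

/-! ### Independent sets and iso-toughness -/

/-- Greedy choice of an independent set whose closed neighbourhoods cover `T`, heaviest vertices
first. -/
lemma exists_independent_weight_le {α : Type*} [DecidableEq α] (adj : α → α → Prop)
    (hsymm : ∀ u v, adj u v → adj v u) (hirrefl : ∀ v, ¬ adj v v) (w d : α → ℕ) (T : Finset α)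
    (hd : ∀ v ∈ T, ∀ N ⊆ T, (∀ u ∈ N, adj v u) → N.card ≤ d v) :
    ∃ I ⊆ T, (∀ u ∈ I, ∀ v ∈ I, ¬ adj u v) ∧ ∑ v ∈ T, w v ≤ ∑ v ∈ I, (d v + 1) * w v := by
  classical
  induction T using Finset.strongInduction with
  | H T ih =>
    rcases T.eq_empty_or_nonempty with rfl | hT
    · exact ⟨∅, by simp⟩
    obtain ⟨v, hv, hmax⟩ := exists_max_image T w hT
    let N := T.filter fun u => adj v u
    let T' := T.filter fun u => u ≠ v ∧ ¬ adj v u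
    have hT' : T' ⊆ T := filter_subset _ _
    have hvT' : v ∉ T' := by simp [T']
    obtain ⟨I, hI, hind, hsum⟩ := ih T' ((ssubset_iff_of_subset hT').2 ⟨v, hv, hvT'⟩)
      fun u hu M hM => hd u (hT' hu) M (hM.trans hT')
    refine ⟨insert v I, insert_subset hv (hI.trans hT'), ?_, ?_⟩
    · have hvI : ∀ u ∈ I, ¬ adj v u := fun u hu => (mem_filter.1 (hI hu)).2.2
      intro a ha b hb
      rcases mem_insert.1 ha with rfl | haI <;> rcases mem_insert.1 hb with rfl | hbI
      · exact hirrefl _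
      · exact hvI b hbI
      · exact fun h => hvI a haI (hsymm _ _ h)
      · exact hind a haI b hbI
    · rw [sum_insert fun h => hvT' (hI h)]
      have hcover : T ⊆ insert v N ∪ T' := by
        intro u hu
        simp only [mem_union, mem_insert, N, T', mem_filter]
        tauto
      have hN : ∑ u ∈ insert v N, w u ≤ (d v + 1) * w v := by
        refine (sum_le_card_nsmul _ _ (w v) fun u hu => hmax u ?_).trans ?_
        · exact insert_subset hv (filter_subset _ _) hu
        · rw [smul_eq_mul]
          refine Nat.mul_le_mul_right _ ((card_insert_le _ _).trans ?_)
          exact Nat.add_le_add_right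
            (hd v hv N (filter_subset _ _) fun u hu => (mem_filter.1 hu).2) 1
      calc ∑ u ∈ T, w u ≤ ∑ u ∈ insert v N ∪ T', w u := sum_le_sum_of_subset hcover
        _ ≤ ∑ u ∈ insert v N, w u + ∑ u ∈ T', w u := by
            rw [← sum_union_inter]; exact Nat.le_add_right _ _
        _ ≤ _ := Nat.add_le_add hN hsum

/-- The degree of `v` in `G \ S` is at least its number of neighbours outside `S`. -/
lemma card_le_edgeDegreeAvoiding {α β : Type*} {G : Graph α β} {E : Finset β}
    (hE : ∀ e ∈ G.edgeSet, e ∈ E) {S N : Finset α} {v : α} (hv : v ∉ S) (hN : ∀ u ∈ N, u ∉ S)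
    (hadj : ∀ u ∈ N, G.Adj v u) : N.card ≤ edgeDegreeAvoiding G E S v := by
  classical
  refine card_le_card_of_forall_subsingleton (fun u e => G.IsLink e v u) (fun u hu => ?_)
    fun e _ u hu u' hu' => hu.2.right_unique hu'.2
  obtain ⟨e, hl⟩ := hadj u hu
  refine ⟨e, mem_filter.2 ⟨hE e hl.edge_mem, hl.inc_left, fun x hx hi => ?_⟩, hl⟩
  rcases hi.eq_or_eq_of_isLink hl with rfl | rfl
  · exact hv hx
  · exact hN _ hu hx

/-- Iso-toughness bounds the weight of an independent set of `G \ S`. -/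
lemma IsIsoTough.sum_le {α β : Type*} [DecidableEq α] {G : Graph α β} {V : Finset α}
    {E : Finset β} (hV : ∀ v, v ∈ V ↔ v ∈ G.vertexSet) (hE : ∀ e, e ∈ E ↔ e ∈ G.edgeSet)
    {t : α → ℝ} (ht : ∀ v, 0 ≤ t v) (hG : IsIsoTough G t) {S I : Finset α} (hS : S ⊆ V)
    (hI : I ⊆ V \ S) (hind : ∀ u ∈ I, ∀ v ∈ I, ¬ G.Adj u v) :
    ∑ v ∈ I, t v ≤ S.card + ∑ v ∈ I, (edgeDegreeAvoiding G E S v : ℝ) := by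
  classical
  let N : α → Finset α := fun v => (V \ S).filter fun u => G.Adj v u
  let S' : Finset α := S ∪ I.biUnion N
  have hNcard : ∀ v ∈ I, (N v).card ≤ edgeDegreeAvoiding G E S v := by
    intro v hv
    exact card_le_edgeDegreeAvoiding (fun e he => (hE e).2 he) (mem_sdiff.1 (hI hv)).2
      (fun u hu => (mem_sdiff.1 (mem_filter.1 hu).1).2) fun u hu => (mem_filter.1 hu).2
  have hcard : S'.card ≤ S.card + ∑ v ∈ I, edgeDegreeAvoiding G E S v :=
    (card_union_le _ _).trans (Nat.add_le_add_left (card_biUnion_le.trans (sum_le_sum hNcard)) _)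
  have hS' : (S' : Set α) ⊆ G.vertexSet := by
    intro v hv
    rcases mem_union.1 (mem_coe.1 hv) with h | h
    · exact (hV v).1 (hS h)
    · obtain ⟨u, _, hu⟩ := mem_biUnion.1 h
      exact (hV v).1 (mem_sdiff.1 (mem_filter.1 hu).1).1
  have hiso : ∀ v ∈ I, v ∈ isolatedVertices (G.deleteVerts S') := by
    intro v hv
    have hvV := mem_sdiff.1 (hI hv)
    refine ⟨?_, ?_⟩
    · rw [Graph.vertexSet_deleteVerts]
      refine ⟨(hV v).1 hvV.1, fun h => ?_⟩
      rcases mem_union.1 (mem_coe.1 h) with h | h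
      · exact hvV.2 h
      · obtain ⟨u, hu, huv⟩ := mem_biUnion.1 h
        exact hind u hu v hv (mem_filter.1 huv).2
    · rintro e ⟨w, hl⟩
      rw [Graph.deleteVerts_isLink] at hl
      obtain ⟨hl, -, hw⟩ := hl
      refine hw (mem_coe.2 ?_)
      by_cases hwS : w ∈ S
      · exact mem_union_left _ hwS
      · exact mem_union_right _ (mem_biUnion.2 ⟨v, hv, mem_filter.2
          ⟨mem_sdiff.2 ⟨(hV w).2 hl.right_mem, hwS⟩, e, hl⟩⟩)
  have hfin : (isolatedVertices (G.deleteVerts S')).Finite := by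
    refine V.finite_toSet.subset fun v hv => ?_
    have := hv.1
    rw [Graph.vertexSet_deleteVerts] at this
    exact mem_coe.2 ((hV v).2 this.1)
  have h := hG S' hS'
  rw [finsum_mem_eq_finite_toFinset_sum _ hfin, Set.ncard_coe_finset] at h
  -- Vertices outside `I` may become isolated too; `0 ≤ t` makes them harmless.
  calc ∑ v ∈ I, t v ≤ ∑ v ∈ hfin.toFinset, t v :=
        sum_le_sum_of_subset_of_nonneg (fun v hv => hfin.mem_toFinset.2 (hiso v hv))
          fun v _ _ => ht v
    _ ≤ S'.card := h
    _ ≤ _ := by exact_mod_cast hcard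

/-- Iso-toughness with respect to a function `t` that dominates `d + (d + 1) (g - d) / m` for all
degrees `d < g` gives a `(g, f)`-factor. -/
theorem IsIsoTough.exists_isFactor {α β : Type*} {G : Graph α β} (hloop : G.Loopless)
    (hV : G.vertexSet.Finite) (hE : G.edgeSet.Finite) {g f : α → ℕ} {m : ℕ} (hm : 0 < m)
    (hmf : ∀ v ∈ G.vertexSet, m ≤ f v) (hgf : ∀ v ∈ G.vertexSet, g v < f v) {t : α → ℝ}
    (ht : ∀ v, 0 ≤ t v)
    (hdom : ∀ v ∈ G.vertexSet, ∀ d < g v,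
      (d : ℝ) + ((d : ℝ) + 1) * ((g v : ℝ) - d) / m ≤ t v)
    (hG : IsIsoTough G t) : ∃ F : Graph α β, IsFactor G F g f := by
  classical
  have hV' : ∀ v, v ∈ hV.toFinset ↔ v ∈ G.vertexSet := fun v => hV.mem_toFinset
  have hE' : ∀ e, e ∈ hE.toFinset ↔ e ∈ G.edgeSet := fun e => hE.mem_toFinset
  refine exists_isFactor_of_deficiency (E := hE.toFinset) hloop hV'
    (fun v hv => hgf v ((hV' v).1 hv)) fun S hS => ?_
  let d : α → ℕ := edgeDegreeAvoiding G hE.toFinset S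
  let T : Finset α := (hV.toFinset \ S).filter fun v => d v < g v
  have hTV : T ⊆ hV.toFinset \ S := filter_subset _ _
  have hT : ∑ v ∈ hV.toFinset \ S, (g v - d v) = ∑ v ∈ T, (g v - d v) := by
    refine (sum_subset hTV fun v hv hvT => ?_).symm
    have : ¬ d v < g v := fun h => hvT (mem_filter.2 ⟨hv, h⟩)
    omega
  obtain ⟨I, hIT, hind, hsum⟩ := exists_independent_weight_le G.Adj (fun _ _ h => h.symm)
    (fun v => G.not_adj_self v) (fun v => g v - d v) d T
    fun v hv N hN hadj => card_le_edgeDegreeAvoiding (fun e he => (hE' e).2 he)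
      (mem_sdiff.1 (hTV hv)).2 (fun u hu => (mem_sdiff.1 (hTV (hN hu))).2) hadj
  have hm' : (0 : ℝ) < m := by exact_mod_cast hm
  have htough := hG.sum_le hV' hE' ht hS (hIT.trans hTV) hind
  have hpoint : ∀ v ∈ I, (((d v + 1) * (g v - d v) : ℕ) : ℝ) ≤ m * (t v - d v) := by
    intro v hv
    have hdv : d v < g v := (mem_filter.1 (hIT hv)).2
    have hvG : v ∈ G.vertexSet := (hV' v).1 (mem_sdiff.1 (hTV (hIT hv))).1
    have h := hdom v hvG (d v) hdv
    have h2 : ((d v : ℝ) + 1) * ((g v : ℝ) - d v) / m ≤ t v - d v := by linarith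
    rw [div_le_iff₀ hm'] at h2
    rw [Nat.cast_mul, Nat.cast_sub hdv.le, Nat.cast_add_one]
    linarith
  have key : ((∑ v ∈ I, (d v + 1) * (g v - d v) : ℕ) : ℝ) ≤ ((m * S.card : ℕ) : ℝ) := by
    rw [Nat.cast_sum]
    refine (sum_le_sum hpoint).trans ?_
    rw [← mul_sum, sum_sub_distrib, Nat.cast_mul]
    exact mul_le_mul_of_nonneg_left (by linarith) hm'.le
  calc ∑ v ∈ hV.toFinset \ S, (g v - d v) = ∑ v ∈ T, (g v - d v) := hT
    _ ≤ ∑ v ∈ I, (d v + 1) * (g v - d v) := hsum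
    _ ≤ m * S.card := by exact_mod_cast key
    _ = ∑ v ∈ S, m := by simp [mul_comm]
    _ ≤ ∑ v ∈ S, f v := sum_le_sum fun v hv => hmf v ((hV' v).1 (hS hv))

/-! ### Estimates for the threshold function -/

/-- With `a = d + k + 1` the two sides differ by `k (m - d) / m`; either `k = 0`, or `a ≤ m + 2`
forces `d ≤ m`. -/
lemma le_sub_one_add_div {a m d : ℕ} (hm : 0 < m) (ha : a ≤ m + 2) (hd : d < a) :
    (d : ℝ) + ((d : ℝ) + 1) * ((a : ℝ) - d) / m ≤ (a : ℝ) - 1 + (a : ℝ) / m := by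
  have hm' : (0 : ℝ) < m := by exact_mod_cast hm
  obtain ⟨k, rfl⟩ := Nat.exists_eq_add_of_lt hd
  have hk : (k : ℝ) * d ≤ k * m := by
    rcases Nat.eq_zero_or_pos k with rfl | hk
    · simp
    · exact mul_le_mul_of_nonneg_left (by exact_mod_cast (by omega : d ≤ m)) (by positivity)
  push_cast
  rw [← sub_nonneg]
  have : (d : ℝ) + k + 1 - 1 + (d + k + 1) / m - (d + (d + 1) * (d + k + 1 - d) / m) =
      (k * m - k * d) / m := by
    field_simp
    ring
  rw [this]
  exact div_nonneg (by linarith) hm'.le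

/-- The left side is `(d + 1)(a + m - d) / m - 1`, a concave parabola in `d` with vertex `(a + m -
1) / 2`. If `a` and `m` have the same parity, no integer attains the vertex, which saves `1 / (4
m)`. -/
lemma le_threshold {a m d : ℕ} (hm : 0 < m) (hd : d < a) :
    (d : ℝ) + ((d : ℝ) + 1) * ((a : ℝ) - d) / m ≤ threshold a m := by
  unfold threshold
  split_ifs with ha
  · exact le_sub_one_add_div hm ha hd
  have hm' : (0 : ℝ) < m := by exact_mod_cast hm
  have hpar : parityTerm a m ≤ ((a : ℝ) + m - 1 - 2 * d) ^ 2 := by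
    unfold parityTerm
    split_ifs with h
    · have hne : ((a : ℤ) + m - 1 - 2 * d) ≠ 0 := by omega
      have : (1 : ℤ) ≤ ((a : ℤ) + m - 1 - 2 * d) ^ 2 := by
        have := sq_pos_of_ne_zero hne
        omega
      exact_mod_cast this
    · positivity
  rw [← sub_nonneg]
  have : 1 / (4 * (m : ℝ)) * (((a : ℝ) + m + 1) ^ 2 - parityTerm a m) - 1 -
      (d + (d + 1) * (a - d) / m) =
      (((a : ℝ) + m - 1 - 2 * d) ^ 2 - parityTerm a m) / (4 * m) := by
    field_simp
    ring
  rw [this]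
  exact div_nonneg (by linarith) (by positivity)

lemma minValue_le {α β : Type*} {G : Graph α β} {f : α → ℕ} {v : α} (hv : v ∈ G.vertexSet) :
    minValue G f ≤ f v :=
  Nat.sInf_le ⟨v, hv, rfl⟩

lemma le_maxValue {α β : Type*} {G : Graph α β} (hV : G.vertexSet.Finite) {g : α → ℕ} {v : α}
    (hv : v ∈ G.vertexSet) : g v ≤ maxValue G g :=
  le_csSup (hV.image g).bddAbove ⟨v, hv, rfl⟩

lemma isFactor_self_of_vertexSet_eq_empty {α β : Type*} {G : Graph α β}
    (h : G.vertexSet = ∅) (g f : α → ℕ) : IsFactor G G g f :=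
  ⟨⟨le_refl G, rfl⟩, by simp [h]⟩

lemma minValue_pos {α β : Type*} {G : Graph α β} {g f : α → ℕ} (h : G.vertexSet.Nonempty)
    (hgf : ∀ v ∈ G.vertexSet, g v < f v) : 0 < minValue G f := by
  obtain ⟨v, hv, hvf⟩ := Nat.sInf_mem (h.image f)
  have := hgf v hv
  unfold minValue
  omega

end IsoTough

theorem mainTheorem10 {α β : Type*} (G : Graph α β) (hloop : G.Loopless)
    (hV : G.vertexSet.Finite) (hE : G.edgeSet.Finite) :
    (∀ g f : α → ℕ, (∀ v ∈ G.vertexSet, g v < f v) →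
      IsoTough.IsIsoTough G
        (fun v => max 0 (IsoTough.threshold (g v) (IsoTough.minValue G f))) →
      ∃ F : Graph α β, IsoTough.IsFactor G F g f) ∧
    (∀ g f : α → ℕ, IsoTough.maxValue G g < IsoTough.minValue G f →
      IsoTough.IsIsoTough G
        (fun v => max 0 ((g v : ℝ) - 1 + (g v : ℝ) / (IsoTough.minValue G f : ℝ))) →
      ∃ F : Graph α β, IsoTough.IsFactor G F g f) ∧
    (∀ f : α → ℕ,
      IsoTough.IsIsoTough G (fun v => (f v : ℝ) * ((f v : ℝ) + 1)) →
      ∃ F : Graph α β, IsoTough.IsFactor G F f (fun v => f v + 1)) := by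
  refine ⟨fun g f hgf hG => ?_, fun g f hgf hG => ?_, fun f hG => ?_⟩
  -- On an empty graph `minValue` is `sInf ∅ = 0`, so positivity fails there.
  · rcases G.vertexSet.eq_empty_or_nonempty with h | h
    · exact ⟨G, IsoTough.isFactor_self_of_vertexSet_eq_empty h g f⟩
    have hm := IsoTough.minValue_pos h hgf
    exact hG.exists_isFactor hloop hV hE hm (fun v hv => IsoTough.minValue_le hv) hgf
      (fun v => le_max_left _ _)
      fun v _ d hd => (IsoTough.le_threshold hm hd).trans (le_max_right _ _)
  · have hlt : ∀ v ∈ G.vertexSet, g v < IsoTough.minValue G f := fun v hv =>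
      (IsoTough.le_maxValue hV hv).trans_lt hgf
    exact hG.exists_isFactor hloop hV hE (by omega) (fun v hv => IsoTough.minValue_le hv)
      (fun v hv => (hlt v hv).trans_le (IsoTough.minValue_le hv)) (fun v => le_max_left _ _)
      fun v hv d hd => (IsoTough.le_sub_one_add_div (by omega) (by have := hlt v hv; omega)
        hd).trans (le_max_right _ _)
  -- The crude bound `m = 1 ≤ f + 1` already suffices here.
  · refine hG.exists_isFactor hloop hV hE one_pos (fun v _ => by simp) (fun v _ => by simp)
      (fun v => by positivity) fun v _ d hd => ?_
    have hd' : (d : ℝ) + 1 ≤ f v := by exact_mod_cast hd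
    have hd0 : (0 : ℝ) ≤ d := by positivity
    rw [Nat.cast_one, div_one]
    nlinarith
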